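/- Let $p\ge 2$ and $m_1,m_2\ge 2$ be integers, let $\lambda_1\ne\lambda_2$ be nonzero complex numbers, put $r=m_1+m_2$, and let $A\in M_d(\mathbb C)$ satisfy $P(A)=0$, where $$P(z)=(z-\lambda_1)^{m_1}(z-\lambda_2)^{m_2}=z^r-a_0z^{r-1}-\cdots-a_{r-1}.$$ Let $A_s=P_s(A)$, where $P_0(z)=1$ and $P_{j+1}(z)=zP_j(z)-a_j$. For $i\in\{1,2\}$, with $i'$ denoting the other index, let $$\gamma^{[i]}_h=(-1)^{m_{i'}}\frac{\binom{m_i-h-1+m_{i'}-1}{m_i-h-1}}{(\lambda_{i'}-\lambda_i)^{m_i-h-1+m_{i'}}}\quad(0\le h\le m_i-1),$$ $$C_{i,j}=\sum_{h=j}^{m_i-1}\lambda_i^{r-1-h}\,\gamma^{[i]}_h\sum_{k=j}^{h}\binom{r-1}{h-k}\frac{S_{k,j}}{k!}\quad(0\le j\le m_i-1),$$ where $S_{k,j}$ are the signed Stirling numbers of the first kind, $x(x-1)\cdots(x-k+1)=\sum_j S_{k,j}x^j$. Let $D=t\frac{d}{dt}$, let $z^{1/p}$ be the principal branch (with $-\pi<\arg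 z\le\pi$ and $0^{1/p}=0$), let $\rho$ denote the spectral radius, and let $b_n=\frac{(-1)^n}{n!}\prod_{k=0}^{n-1}\left(\frac1p-k\right)$ be the Taylor coefficients of $(1-z)^{1/p}$ at $0$. Then for every real $t\ne 0$ with $|t|\rho(A)<1$, $$(I-tA)^{1/p}=\sum_{s=0}^{m_1+m_2-1}\varphi_s(t)A_s,$$ where $$\varphi_0(t)=\sum_{i=1}^2\sum_{j=0}^{m_i-1}C_{i,j}\,D^j(1-\lambda_it)^{1/p},$$ and, for $s\ge 1$, $$\varphi_s(t)=\sum_{i=1}^2\frac{C_{i,0}}{\lambda_i^s}(1-\lambda_it)^{1/p}+\sum_{i=1}^2\sum_{j=1}^{m_i-1}\sum_{k=0}^{j}\frac{C_{i,j}}{\lambda_i^s}\binom jk(-s)^{j-k}D^k(1-\lambda_it)^{1/p}.$$ Here $(I-tA)^{1/p}$ is the sum of the convergent series $\sum_{n\ge0}b_nt^nA^n$, and it is the principal $p$th root of $I-tA$, that is, the unique matrix $X$ with $X^p=I-tA$ all of whose eigenvalues $z$ satisfy $z\neq 0$ and $|\arg z|<\pi/p$. (If $\lambda_it=1$, which can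 happen only when $\lambda_i$ is not an eigenvalue of $A$, a derivative that does not exist is read as $0$.) -/

import Mathlib

open Polynomial

noncomputable section

namespace MatrixRoot

/-- The coefficients `a_0, a_1, …, a_{r-1}` of a monic polynomial written in the form
`P(z) = z^r - a_0 z^(r-1) - ⋯ - a_{r-1}` with `r = deg P`. -/
def fibCoeff (P : ℂ[X]) (j : ℕ) : ℂ :=
  -P.coeff (P.natDegree - 1 - j)

/-- The Horner polynomials of `P`: `P_0 = 1` and `P_{j+1}(z) = z P_j(z) - a_j`. -/
def hornerPoly (P : ℂ[X]) : ℕ → ℂ[X]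
  | 0 => 1
  | j + 1 => X * hornerPoly P j - C (fibCoeff P j)

/-- The Fibonacci-Horner system `A_s = P_s(A)` of the matrix `A` with respect to `P`. -/
def hornerSystem {d : ℕ} (P : ℂ[X]) (A : Matrix (Fin d) (Fin d) ℂ) (s : ℕ) :
    Matrix (Fin d) (Fin d) ℂ :=
  aeval A (hornerPoly P s)

/-- The (signed) Stirling numbers of the first kind `S_{k,j}`, that is
`x (x - 1) ⋯ (x - k + 1) = ∑ j, S_{k,j} x^j`. -/
def stirlingSigned (k j : ℕ) : ℂ :=
  (-1) ^ (k - j) * (Nat.stirlingFirst k j : ℂ)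

/-- For pairwise distinct `lam i` with multiplicities `m i`, and `r = ∑ i, m i`, the number
`γ_h^{[i]} = (-1)^(r - m_i) ∑ ∏_{t ≠ i} binom(n_t + m_t - 1, n_t) / (lam_t - lam_i)^(n_t + m_t)`,
the outer sum being over the families `(n_t)_{t ≠ i}` of natural numbers with sum
`m_i - h - 1` (used for `h < m_i`). -/
def gammaCoeff {l : ℕ} (lam : Fin l → ℂ) (m : Fin l → ℕ) (i : Fin l) (h : ℕ) : ℂ :=
  (-1) ^ ((∑ t, m t) - m i) *
    ∑ n ∈ Finset.piAntidiag (Finset.univ.erase i) (m i - h - 1),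
      ∏ t ∈ Finset.univ.erase i,
        ((n t + m t - 1).choose (n t) : ℂ) / (lam t - lam i) ^ (n t + m t)

/-- The Binet coefficients
`C_{i,j} = ∑_{h=j}^{m_i-1} lam_i^(r-1-h) γ_h^{[i]} ∑_{k=j}^{h} binom(r-1, h-k) S_{k,j} / k!`,
where `r = ∑ i, m i`. -/
def binetCoeff {l : ℕ} (lam : Fin l → ℂ) (m : Fin l → ℕ) (i : Fin l) (j : ℕ) : ℂ :=
  ∑ h ∈ Finset.Ico j (m i),
    lam i ^ ((∑ t, m t) - 1 - h) * gammaCoeff lam m i h *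
      ∑ k ∈ Finset.Icc j h,
        (((∑ t, m t) - 1).choose (h - k) : ℂ) * (stirlingSigned k j / (k.factorial : ℂ))

/-- The differential operator `D = t d/dt` on complex-valued functions of a real variable. -/
def degreeOp (f : ℝ → ℂ) : ℝ → ℂ :=
  fun t => (t : ℂ) * deriv f t

/-- The function `t ↦ (1 - c t)^(1/p)` (principal branch of the `p`-th root). -/
def rootFun (p : ℕ) (c : ℂ) : ℝ → ℂ :=
  fun t => (1 - c * (t : ℂ)) ^ (1 / (p : ℂ))

/-- The functions `φ_s`: `φ_0 = ∑_i ∑_{j=0}^{m_i-1} C_{i,j} D^j (1 - lam_i t)^(1/p)`, and, for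
`s ≥ 1`, `φ_s = ∑_i C_{i,0} / lam_i^s (1 - lam_i t)^(1/p)
  + ∑_i ∑_{j=1}^{m_i-1} ∑_{k=0}^{j} C_{i,j} / lam_i^s binom(j,k) (-s)^(j-k)
      D^k (1 - lam_i t)^(1/p)`. -/
def phi {l : ℕ} (p : ℕ) (lam : Fin l → ℂ) (m : Fin l → ℕ) (s : ℕ) (t : ℝ) : ℂ :=
  if s = 0 then
    ∑ i, ∑ j ∈ Finset.range (m i),
      binetCoeff lam m i j * (degreeOp^[j] (rootFun p (lam i))) t
  else
    (∑ i, binetCoeff lam m i 0 / lam i ^ s * rootFun p (lam i) t) +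
      ∑ i, ∑ j ∈ Finset.Ico 1 (m i), ∑ k ∈ Finset.range (j + 1),
        binetCoeff lam m i j / lam i ^ s * (j.choose k : ℂ) * (-(s : ℂ)) ^ (j - k) *
          (degreeOp^[k] (rootFun p (lam i))) t

/-- The Taylor coefficients of `(1 - z)^(1/p)` at `0`:
`b_n = (-1)^n (1/p) (1/p - 1) ⋯ (1/p - n + 1) / n!`. -/
def taylorCoeff (p n : ℕ) : ℂ :=
  (-1) ^ n * (∏ k ∈ Finset.range n, (1 / (p : ℂ) - (k : ℂ))) / (n.factorial : ℂ)

/-- `X` is a principal `p`-th root of `B`: `X ^ p = B` and every eigenvalue `z` of `X` satisfies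
`z ≠ 0` and `|arg z| < π / p`. -/
def IsPrincipalRoot {d : ℕ} (p : ℕ) (B X : Matrix (Fin d) (Fin d) ℂ) : Prop :=
  X ^ p = B ∧ ∀ z ∈ spectrum ℂ X, z ≠ 0 ∧ |Complex.arg z| < Real.pi / p

end MatrixRoot

end

/-! Let `L(q)` be the sum of the residues of `q/P` at the two roots (`residueSum`). It kills
multiples of `P`, and for `deg q < r` it reads off the coefficient of `z^(r-1)`
(`residueSum_eq_coeff`). Hence `u_N = L(z^(N+r-1))` obeys the linear recurrence of `P`, with `u_0 =
1` and `u_{-1} = ⋯ = u_{-(r-1)} = 0`. Computing the residues and applying Vandermonde gives `u_N = ∑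
λ_i^N ∑ C_{i,j} N^j` (`binetSeq_eq_residueSum`). Since `A A_s = A_{s+1} + a_s I` and `A_r = 0`, it
follows that `A^n = ∑ u_{n-s} A_s` (`pow_eq_sum_binetSeq_smul`).

Expanding `(n-s)^j` turns this into `A^n = ∑ n^k λ_i^n E_{i,k}` with fixed matrices `E_{i,k}`
(`component`). After multiplication by `b_n t^n` and summation, the factor `n^k` becomes `D^k`. This
needs `|λ_i t| < 1`, which is known only for eigenvalues; for the other roots `E_{i,k} = 0`
(`component_eq_zero`), so the values of `D^k (1 - λ_i t)^(1/p)` do not matter.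

The sum `X` satisfies `X^p = I - tA` by Cauchy products, and its eigenvalues are `(1 - μt)^(1/p)`
with `|μt| < 1`. Any principal root commutes with its own `p`th power, hence with `A` and with `X`;
commuting principal roots coincide (`IsPrincipalRoot.eq_of_commute`). -/

namespace MatrixRoot

/-! ### Residues of `q / ((z - a)^m (z - b)^n)`, computed with formal power series. -/

section Residue

/-- The coefficients at `0` of `(z + δ)⁻ⁿ`. -/
theorem coeff_inv_X_add_C_pow {δ : ℂ} (hδ : δ ≠ 0) (n k : ℕ) :
    PowerSeries.coeff k ((PowerSeries.X + PowerSeries.C δ : PowerSeries ℂ)⁻¹ ^ (n + 1)) =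
      (-1) ^ k * ((n + k).choose k : ℂ) / δ ^ (n + 1 + k) := by
  have hc : PowerSeries.constantCoeff (PowerSeries.X + PowerSeries.C δ : PowerSeries ℂ) ≠ 0 := by
    simpa using hδ
  have key : ∀ n, (PowerSeries.X + PowerSeries.C δ : PowerSeries ℂ)⁻¹ ^ (n + 1) =
      PowerSeries.mk fun k => (-1) ^ k * ((n + k).choose k : ℂ) / δ ^ (n + 1 + k) := by
    intro n
    induction n with
    | zero =>
      rw [zero_add, pow_one, PowerSeries.inv_eq_iff_mul_eq_one hc]
      ext k
      rw [mul_comm, add_mul, map_add, PowerSeries.coeff_C_mul]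
      rcases k with _ | k
      · simp [hδ]
      · rw [PowerSeries.coeff_succ_X_mul]
        simp [PowerSeries.coeff_one]
        field_simp
        ring
    | succ n ih =>
      rw [pow_succ, ih, eq_comm, PowerSeries.eq_mul_inv_iff_mul_eq hc]
      ext k
      rw [mul_comm, add_mul, map_add, PowerSeries.coeff_C_mul]
      rcases k with _ | k
      · simp
        field_simp
        ring
      · rw [PowerSeries.coeff_succ_X_mul]
        simp only [PowerSeries.coeff_mk]
        have h : n + 1 + (k + 1) = n + k + 1 + 1 := by ring
        rw [h, Nat.choose_succ_succ (n + k + 1) k]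
        rw [show n + 1 + k = n + k + 1 by ring, show n + (k + 1) = n + k + 1 by ring]
        push_cast
        field_simp
        ring
  rw [key, PowerSeries.coeff_mk]

/-- The sum of the residues of `q / ((z - a)^m (z - b)^n)` at `a` and `b`. -/
noncomputable def residueSum (a b : ℂ) (m n : ℕ) : ℂ[X] →ₗ[ℂ] ℂ where
  toFun q :=
    PowerSeries.coeff (m - 1)
        ((PowerSeries.X + PowerSeries.C (a - b) : PowerSeries ℂ)⁻¹ ^ n *
          ((taylor a q : ℂ[X]) : PowerSeries ℂ)) +
      PowerSeries.coeff (n - 1)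
        ((PowerSeries.X + PowerSeries.C (b - a) : PowerSeries ℂ)⁻¹ ^ m *
          ((taylor b q : ℂ[X]) : PowerSeries ℂ))
  map_add' p q := by
    simp only [map_add, Polynomial.coe_add, mul_add]
    ring
  map_smul' c q := by
    simp only [map_smul, Polynomial.coe_smul, mul_smul_comm, smul_eq_mul, RingHom.id_apply]
    ring

variable {a b : ℂ} {m n : ℕ}

theorem taylor_X_sub_C_pow (a b : ℂ) (j : ℕ) :
    ((taylor a ((X - C b) ^ j) : ℂ[X]) : PowerSeries ℂ) =
      (PowerSeries.X + PowerSeries.C (a - b)) ^ j := by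
  rw [taylor_pow]
  simp [add_sub_assoc]

/-- The denominator cancels and no pole remains. -/
theorem residueSum_mul_eq_zero (hm : 1 ≤ m) (hn : 1 ≤ n) (q : ℂ[X]) :
    residueSum a b m n ((X - C a) ^ m * (X - C b) ^ n * q) = 0 := by
  simp only [residueSum, LinearMap.coe_mk, AddHom.coe_mk, taylor_mul, Polynomial.coe_mul,
    taylor_X_sub_C_pow, sub_self, map_zero, add_zero]
  rw [(PowerSeries.X_pow_dvd_iff (n := m)).1 (((dvd_mul_right _ _).mul_right _).mul_left _) _
      (by omega),
    (PowerSeries.X_pow_dvd_iff (n := n)).1 (((dvd_mul_left _ _).mul_right _).mul_left _) _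
      (by omega), add_zero]

theorem X_add_C_pow_mul_inv {δ : ℂ} (hδ : δ ≠ 0) {j m : ℕ} (hj : j ≤ m) :
    (PowerSeries.X + PowerSeries.C δ : PowerSeries ℂ)⁻¹ ^ m *
      (PowerSeries.X + PowerSeries.C δ) ^ j =
      (PowerSeries.X + PowerSeries.C δ : PowerSeries ℂ)⁻¹ ^ (m - j) := by
  obtain ⟨k, rfl⟩ := Nat.exists_eq_add_of_le' hj
  rw [pow_add, mul_assoc, ← mul_pow, PowerSeries.inv_mul_cancel _ (by simpa using hδ), one_pow,
    mul_one, Nat.add_sub_cancel]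

/-- The quotient `(z - a)^(j-m) (z - b)^(-n)` decays at least like `z^(-2)`, so its two residues
must cancel; here they are computed and compared via the symmetry of binomial coefficients. -/
theorem residueSum_pow_left (hab : a ≠ b) (hn : 1 ≤ n) {j : ℕ} (hj : j < m) :
    residueSum a b m n ((X - C a) ^ j) = 0 := by
  simp only [residueSum, LinearMap.coe_mk, AddHom.coe_mk, taylor_X_sub_C_pow, sub_self, map_zero,
    add_zero]
  rw [X_add_C_pow_mul_inv (sub_ne_zero.2 hab.symm) hj.le, PowerSeries.coeff_mul_X_pow',
    if_pos (by omega)]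
  obtain ⟨n, rfl⟩ := Nat.exists_eq_add_of_le' hn
  obtain ⟨k, rfl⟩ : ∃ k, m = k + 1 + j := ⟨m - 1 - j, by omega⟩
  rw [show k + 1 + j - 1 - j = k by omega, show k + 1 + j - j = k + 1 by omega,
    Nat.add_sub_cancel, coeff_inv_X_add_C_pow (sub_ne_zero.2 hab),
    coeff_inv_X_add_C_pow (sub_ne_zero.2 hab.symm), ← neg_sub a b, neg_pow (a - b),
    add_comm k n, ← Nat.choose_symm_add, show k + 1 + n = n + 1 + k by ring]
  have : a - b ≠ 0 := sub_ne_zero.2 hab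
  have h1 : (-1 : ℂ) ^ (n + 1 + k) = (-1) ^ n * (-1) ^ k * (-1) := by ring
  have h3 : (-1 : ℂ) ^ k * (-1) ^ k = 1 := by rw [← mul_pow]; simp
  have h4 : (-1 : ℂ) ^ n ≠ 0 := by simp
  have h5 : (-1 : ℂ) ^ k ≠ 0 := by simp
  rw [h1]
  field_simp
  linear_combination ((n + k).choose n : ℂ) * (h3)

theorem residueSum_pow_mul_pow (hm : 1 ≤ m) (hab : a ≠ b) (j : ℕ) :
    residueSum a b m n ((X - C a) ^ m * (X - C b) ^ j) = if j = n - 1 then 1 else 0 := by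
  simp only [residueSum, LinearMap.coe_mk, AddHom.coe_mk, taylor_mul, Polynomial.coe_mul,
    taylor_X_sub_C_pow, sub_self, map_zero, add_zero]
  rw [← mul_assoc, ← mul_assoc, X_add_C_pow_mul_inv (sub_ne_zero.2 hab.symm) le_rfl, Nat.sub_self,
    pow_zero, one_mul, PowerSeries.coeff_X_pow, mul_right_comm, PowerSeries.coeff_mul_X_pow',
    if_neg (by omega), zero_add]
  simp [eq_comm]

/-- A basis of monic polynomials of degrees `0, 1, …, m + n - 1` on which `residueSum` is easily
computed. -/
theorem exists_monic_residueSum (hm : 1 ≤ m) (hn : 1 ≤ n) (hab : a ≠ b) {N : ℕ} (hN : N < m + n) :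
    ∃ B : ℂ[X], B.Monic ∧ B.natDegree = N ∧
      residueSum a b m n B = if N = m + n - 1 then 1 else 0 := by
  have hX : ∀ (c : ℂ) k, ((X - C c) ^ k).natDegree = k := fun c k => by simp
  rcases lt_or_ge N m with h | h
  · refine ⟨(X - C a) ^ N, (monic_X_sub_C a).pow _, hX _ _, ?_⟩
    rw [residueSum_pow_left hab hn h, if_neg (by omega)]
  · refine ⟨(X - C a) ^ m * (X - C b) ^ (N - m),
      ((monic_X_sub_C a).pow _).mul ((monic_X_sub_C b).pow _), ?_, ?_⟩
    · rw [((monic_X_sub_C a).pow _).natDegree_mul ((monic_X_sub_C b).pow _), hX, hX]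
      omega
    · rw [residueSum_pow_mul_pow hm hab]
      congr 1
      simp only [eq_iff_iff]
      omega

/-- This is the residue at infinity. Both sides are linear, so it suffices to peel off leading terms
along a monic basis on which they agree. -/
theorem residueSum_eq_coeff (hm : 1 ≤ m) (hn : 1 ≤ n) (hab : a ≠ b) {q : ℂ[X]}
    (hq : q.degree < (m + n : ℕ)) : residueSum a b m n q = q.coeff (m + n - 1) := by
  have key : ∀ N ≤ m + n, ∀ q : ℂ[X], q.degree < N →
      residueSum a b m n q = q.coeff (m + n - 1) := by
    intro N
    induction N with
    | zero =>
      intro _ q hq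
      have : q = 0 := by
        by_contra h
        rw [degree_eq_natDegree h] at hq
        simp at hq
      simp [this]
    | succ N ih =>
      intro hN q hq
      obtain ⟨B, hB, hBd, hBr⟩ := exists_monic_residueSum hm hn hab (Nat.lt_of_succ_le hN)
      have hlt : (q - q.coeff N • B).degree < N := by
        rw [degree_lt_iff_coeff_zero] at hq ⊢
        intro k hk
        rcases hk.eq_or_lt with rfl | hk
        · have : B.coeff N = 1 := by rw [← hBd]; exact hB
          simp [this]
        · rw [coeff_sub, coeff_smul, hq k hk, coeff_eq_zero_of_natDegree_lt (p := B) (by rwa [hBd])]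
          simp
      have h := ih (by omega) _ hlt
      have hc : B.coeff (m + n - 1) = if N = m + n - 1 then 1 else 0 := by
        split_ifs with h
        · rw [← h, ← hBd]; exact hB
        · exact coeff_eq_zero_of_natDegree_lt (by omega)
      rw [map_sub, map_smul, hBr, coeff_sub, coeff_smul, hc] at h
      exact sub_left_injective h
  exact key _ le_rfl q hq

theorem residueSum_X_pow (M : ℕ) : residueSum a b m n (X ^ M) =
    (∑ x ∈ Finset.HasAntidiagonal.antidiagonal (m - 1), PowerSeries.coeff x.1
      ((PowerSeries.X + PowerSeries.C (a - b) : PowerSeries ℂ)⁻¹ ^ n) *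
        (a ^ (M - x.2) * (M.choose x.2 : ℂ))) +
    ∑ x ∈ Finset.HasAntidiagonal.antidiagonal (n - 1), PowerSeries.coeff x.1
      ((PowerSeries.X + PowerSeries.C (b - a) : PowerSeries ℂ)⁻¹ ^ m) *
        (b ^ (M - x.2) * (M.choose x.2 : ℂ)) := by
  simp only [residueSum, LinearMap.coe_mk, AddHom.coe_mk, PowerSeries.coeff_mul,
    Polynomial.coeff_coe, taylor_pow, taylor_X, coeff_X_add_C_pow]

end Residue

/-! ### The Binet sequence as a sum of residues. -/

section Binet

theorem stirlingSigned_succ_zero (k : ℕ) : stirlingSigned (k + 1) 0 = 0 := by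
  simp [stirlingSigned]

theorem stirlingSigned_succ_succ (k j : ℕ) :
    stirlingSigned (k + 1) (j + 1) = stirlingSigned k j - k * stirlingSigned k (j + 1) := by
  simp only [stirlingSigned, Nat.stirlingFirst_succ_succ, Nat.add_sub_add_right]
  rcases lt_or_ge k (j + 1) with h | h
  · simp [Nat.stirlingFirst_eq_zero_of_lt h]
  · rw [show k - j = k - (j + 1) + 1 by omega]
    push_cast
    ring

theorem sum_stirlingSigned_mul_pow (x : ℂ) (k : ℕ) :
    ∑ j ∈ Finset.range (k + 1), stirlingSigned k j * x ^ j =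
      ∏ i ∈ Finset.range k, (x - i) := by
  induction k with
  | zero => simp [stirlingSigned]
  | succ k ih =>
    rw [Finset.sum_range_succ', stirlingSigned_succ_zero, zero_mul, add_zero,
      Finset.prod_range_succ, ← ih]
    have h1 : ∑ j ∈ Finset.range (k + 1), stirlingSigned k (j + 1) * x ^ (j + 1) =
        ∑ j ∈ Finset.range (k + 1), stirlingSigned k j * x ^ j - stirlingSigned k 0 := by
      have h2 := Finset.sum_range_succ (fun j => stirlingSigned k j * x ^ j) (k + 1)
      rw [Finset.sum_range_succ'] at h2
      have h3 : stirlingSigned k (k + 1) = 0 := by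
        simp [stirlingSigned, Nat.stirlingFirst_eq_zero_of_lt]
      simp only [h3, pow_zero, mul_one, zero_mul, add_zero] at h2
      rw [← h2]
      ring
    have h4 : (k : ℂ) * stirlingSigned k 0 = 0 := by
      rcases k with _ | k
      · simp
      · rw [stirlingSigned_succ_zero, mul_zero]
    calc _ = ∑ j ∈ Finset.range (k + 1), (stirlingSigned k j * x ^ j * x -
          k * (stirlingSigned k (j + 1) * x ^ (j + 1))) := by
          refine Finset.sum_congr rfl fun j _ => ?_
          rw [stirlingSigned_succ_succ]
          ring
      _ = _ := by
          rw [Finset.sum_sub_distrib, ← Finset.sum_mul, ← Finset.mul_sum, h1]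
          linear_combination h4

theorem ring_choose_eq_prod (x : ℂ) (k : ℕ) :
    Ring.choose x k = (∏ i ∈ Finset.range k, (x - i)) / (k.factorial : ℂ) := by
  have h : ∀ k, (descPochhammer ℤ k).smeval x = ∏ i ∈ Finset.range k, (x - i) := by
    intro k
    induction k with
    | zero => simp
    | succ k ih =>
      rw [descPochhammer_succ_right, Polynomial.smeval_mul, ih, Finset.prod_range_succ]
      simp [Polynomial.smeval_natCast]
  rw [Ring.choose_eq_smul, h, smul_eq_mul, div_eq_inv_mul]

/-- Vandermonde's identity with the generalized binomial coefficients written through Stirling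
numbers of the first kind. -/
theorem sum_choose_mul_sum_stirlingSigned (R M : ℕ) (x : ℂ) (hx : x + R = M) (h : ℕ) :
    ∑ j ∈ Finset.range (h + 1), (∑ k ∈ Finset.Icc j h,
      (R.choose (h - k) : ℂ) * (stirlingSigned k j / (k.factorial : ℂ))) * x ^ j =
      (M.choose h : ℂ) := by
  simp only [Finset.sum_mul]
  rw [Finset.sum_comm' (t' := Finset.range (h + 1)) (s' := fun k => Finset.range (k + 1))
    (by intro j k; simp; omega)]
  rw [← Ring.choose_natCast, ← hx, Ring.add_choose_eq _ (Commute.all _ _),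
    Finset.Nat.sum_antidiagonal_eq_sum_range_succ
      (f := fun i j => Ring.choose x i * Ring.choose (R : ℂ) j)]
  refine Finset.sum_congr rfl fun k _ => ?_
  rw [ring_choose_eq_prod, Ring.choose_natCast, ← sum_stirlingSigned_mul_pow, div_mul_eq_mul_div,
    Finset.sum_mul, Finset.sum_div]
  exact Finset.sum_congr rfl fun j _ => by ring

/-- Vandermonde converts the Stirling form of the coefficients into the binomials `M.choose h` that
occur in the Taylor expansion of `z^M` at `lam i`. -/
theorem sum_binetCoeff_mul_pow {l : ℕ} (lam : Fin l → ℂ) (m : Fin l → ℕ) (i : Fin l) (M : ℕ)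
    (x : ℂ) (hx : x + ((∑ t, m t) - 1 : ℕ) = M) :
    ∑ j ∈ Finset.range (m i), binetCoeff lam m i j * x ^ j =
      ∑ h ∈ Finset.range (m i),
        lam i ^ ((∑ t, m t) - 1 - h) * gammaCoeff lam m i h * (M.choose h : ℂ) := by
  simp only [binetCoeff, Finset.sum_mul]
  rw [Finset.sum_comm' (t' := Finset.range (m i)) (s' := fun h => Finset.range (h + 1))
    (by intro j k; simp; omega)]
  refine Finset.sum_congr rfl fun h _ => ?_
  rw [← sum_choose_mul_sum_stirlingSigned _ M x hx h, Finset.mul_sum]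
  exact Finset.sum_congr rfl fun j _ => by ring

theorem piAntidiag_singleton {ι : Type*} [DecidableEq ι] (i : ι) (n : ℕ) :
    Finset.piAntidiag {i} n = {Pi.single i n} := by
  ext f
  simp only [Finset.mem_piAntidiag, Finset.sum_singleton, Finset.mem_singleton]
  refine ⟨fun ⟨h, h'⟩ => ?_, ?_⟩
  · ext j
    by_cases hj : j = i
    · subst hj
      simpa using h
    · rw [Pi.single_eq_of_ne hj]
      by_contra hf
      exact hj (h' j hf)
  · rintro rfl
    refine ⟨by simp, fun j hj => ?_⟩
    by_contra hji
    exact hj (Pi.single_eq_of_ne hji _)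

theorem sum_fin_two_of_ne {M : Type*} [AddCommMonoid M] (f : Fin 2 → M) {i i' : Fin 2}
    (hi : i ≠ i') : ∑ t, f t = f i + f i' := by
  rw [Fin.sum_univ_two]
  fin_cases i <;> fin_cases i' <;> simp_all [add_comm]

/-- Identifies `γ_h` as a Taylor coefficient at `lam i` of the other factor's inverse, the form in
which it enters the residue. -/
theorem gammaCoeff_eq_coeff (lam : Fin 2 → ℂ) (m : Fin 2 → ℕ) {i i' : Fin 2} (hi : i ≠ i')
    (hm : 1 ≤ m i') (hne : lam i ≠ lam i') (h : ℕ) : gammaCoeff lam m i h =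
      PowerSeries.coeff (m i - h - 1)
        ((PowerSeries.X + PowerSeries.C (lam i - lam i') : PowerSeries ℂ)⁻¹ ^ m i') := by
  have e : (Finset.univ.erase i : Finset (Fin 2)) = {i'} := by
    clear hm hne
    revert i i'
    decide
  have hd := sub_ne_zero.2 hne
  obtain ⟨n, hn⟩ := Nat.exists_eq_add_of_le' hm
  simp only [gammaCoeff, e, piAntidiag_singleton, sum_fin_two_of_ne m hi, Finset.prod_singleton,
    Finset.sum_singleton, Pi.single_eq_same, hn, coeff_inv_X_add_C_pow hd, Nat.add_sub_cancel_left]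
  generalize m i - h - 1 = k
  rw [show k + (n + 1) - 1 = n + k by omega, ← neg_sub (lam i), neg_pow (lam i - lam i'),
    show k + (n + 1) = n + 1 + k by ring, pow_add (-1 : ℂ) (n + 1) k]
  have h3 : (-1 : ℂ) ^ k * (-1) ^ k = 1 := by rw [← mul_pow]; simp
  have h4 : (-1 : ℂ) ^ (n + 1) ≠ 0 := by simp
  have h5 : (-1 : ℂ) ^ k ≠ 0 := by simp
  field_simp
  linear_combination -((n + k).choose k : ℂ) * h3

/-- The general Binet sequence `N ↦ ∑ i, lam i ^ N ∑ j, C_{i,j} N ^ j`. -/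
noncomputable def binetSeq {l : ℕ} (lam : Fin l → ℂ) (m : Fin l → ℕ) (N : ℤ) : ℂ :=
  ∑ i, lam i ^ N * ∑ j ∈ Finset.range (m i), binetCoeff lam m i j * (N : ℂ) ^ j

theorem binetSeq_eq_residueSum (lam : Fin 2 → ℂ) (m : Fin 2 → ℕ) (hm : ∀ i, 1 ≤ m i)
    (hne : lam 0 ≠ lam 1) (h0 : ∀ i, lam i ≠ 0) (N : ℤ) (M : ℕ)
    (hM : N + (m 0 + m 1 - 1 : ℕ) = M) :
    binetSeq lam m N = residueSum (lam 0) (lam 1) (m 0) (m 1) (X ^ M) := by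
  have key : ∀ i i' : Fin 2, i ≠ i' → lam i ≠ lam i' →
      lam i ^ N * ∑ j ∈ Finset.range (m i), binetCoeff lam m i j * (N : ℂ) ^ j =
      ∑ x ∈ Finset.HasAntidiagonal.antidiagonal (m i - 1), PowerSeries.coeff x.1
      ((PowerSeries.X + PowerSeries.C (lam i - lam i') : PowerSeries ℂ)⁻¹ ^ m i') *
        (lam i ^ (M - x.2) * (M.choose x.2 : ℂ)) := by
    intro i i' hi hl
    have hr := sum_fin_two_of_ne m hi
    rw [sum_binetCoeff_mul_pow lam m i M, Finset.mul_sum, ← Finset.Nat.sum_antidiagonal_swap,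
      Finset.Nat.sum_antidiagonal_eq_sum_range_succ_mk, Nat.succ_eq_add_one,
      Nat.sub_add_cancel (hm i)]
    · refine Finset.sum_congr rfl fun h hh => ?_
      rw [Finset.mem_range] at hh
      simp only [Prod.fst_swap, Prod.snd_swap]
      rw [gammaCoeff_eq_coeff lam m hi (hm i') hl, show m i - h - 1 = m i - 1 - h by omega]
      -- For `h > M` the truncated exponent `M - h` is wrong, but the binomial coefficient vanishes.
      rcases lt_or_ge M h with hMh | hMh
      · simp [Nat.choose_eq_zero_of_lt hMh]
      · have : lam i ^ N * lam i ^ ((∑ t, m t) - 1 - h) = lam i ^ (M - h) := by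
          rw [← zpow_natCast, ← zpow_natCast, ← zpow_add₀ (h0 i)]
          congr 1
          rw [Fin.sum_univ_two] at hr ⊢
          have := hm i
          have := hm i'
          omega
        rw [← this]
        ring
    · rw [Fin.sum_univ_two]
      exact_mod_cast hM
  rw [residueSum_X_pow, binetSeq, Fin.sum_univ_two, key 0 1 (by decide) hne,
    key 1 0 (by decide) hne.symm]

theorem binetSeq_neg (lam : Fin 2 → ℂ) (m : Fin 2 → ℕ) (hm : ∀ i, 1 ≤ m i)
    (hne : lam 0 ≠ lam 1) (h0 : ∀ i, lam i ≠ 0) {s : ℕ} (hs : s < m 0 + m 1) :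
    binetSeq lam m (-s) = if s = 0 then 1 else 0 := by
  rw [binetSeq_eq_residueSum lam m hm hne h0 (-s) (m 0 + m 1 - 1 - s) (by omega),
    residueSum_eq_coeff (hm 0) (hm 1) hne, coeff_X_pow]
  · congr 1
    simp only [eq_iff_iff]
    omega
  · rw [degree_X_pow]
    exact_mod_cast (by omega : m 0 + m 1 - 1 - s < m 0 + m 1)

end Binet

/-! ### Powers of `A` in the Fibonacci-Horner system. -/

section Horner

/-- Each Horner step restores one dropped low coefficient of `P`. At `j = deg P` this returns `P`
itself, whence `A_r = 0`. -/
theorem hornerPoly_eq_divX {P : ℂ[X]} (hP : P.Monic) {j : ℕ} (hj : j ≤ P.natDegree) :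
    hornerPoly P j = divX^[P.natDegree - j] P := by
  have hc : ∀ i n, (divX^[i] P).coeff n = P.coeff (n + i) := by
    intro i
    induction i with
    | zero => simp
    | succ i ih =>
      intro n
      rw [Function.iterate_succ_apply', coeff_divX, ih]
      congr 1
      ring
  induction j with
  | zero =>
    ext n
    rw [hornerPoly, Nat.sub_zero, hc, coeff_one]
    rcases n with _ | n
    · simpa using hP.symm
    · rw [coeff_eq_zero_of_natDegree_lt (by omega), if_neg (by omega)]
  | succ j ih =>
    rw [hornerPoly, ih (by omega), fibCoeff, ← divX_mul_X_add (divX^[P.natDegree - (j + 1)] P),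
      hc, ← Function.iterate_succ_apply' divX, zero_add,
      show (P.natDegree - (j + 1)).succ = P.natDegree - j by omega,
      show P.natDegree - 1 - j = P.natDegree - (j + 1) by omega, C_neg, mul_comm]
    ring

theorem eq_X_pow_sub_sum_fibCoeff {P : ℂ[X]} (hP : P.Monic) :
    P = X ^ P.natDegree - ∑ s ∈ Finset.range P.natDegree,
      fibCoeff P s • X ^ (P.natDegree - 1 - s) := by
  conv_lhs => rw [hP.as_sum]
  rw [← Finset.sum_range_reflect, sub_eq_add_neg, ← Finset.sum_neg_distrib]
  simp [fibCoeff, smul_eq_C_mul]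

theorem hornerSystem_succ {d : ℕ} (P : ℂ[X]) (A : Matrix (Fin d) (Fin d) ℂ) (s : ℕ) :
    A * hornerSystem P A s = hornerSystem P A (s + 1) + fibCoeff P s • 1 := by
  simp [hornerSystem, hornerPoly, Algebra.algebraMap_eq_smul_one]

theorem hornerSystem_natDegree {d : ℕ} {P : ℂ[X]} (hP : P.Monic) (A : Matrix (Fin d) (Fin d) ℂ)
    (hA : aeval A P = 0) : hornerSystem P A P.natDegree = 0 := by
  rw [hornerSystem, hornerPoly_eq_divX hP le_rfl, Nat.sub_self]
  exact hA

variable {d : ℕ} (A : Matrix (Fin d) (Fin d) ℂ) (lam : Fin 2 → ℂ) (m : Fin 2 → ℕ)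

/-- Apply `residueSum` to `z^n P` and expand `P` in its coefficients. -/
theorem binetSeq_recurrence (hm : ∀ i, 1 ≤ m i)
    (hne : lam 0 ≠ lam 1) (h0 : ∀ i, lam i ≠ 0) {P : ℂ[X]}
    (hP : P = (X - C (lam 0)) ^ m 0 * (X - C (lam 1)) ^ m 1) (hPd : P.natDegree = m 0 + m 1)
    (hPm : P.Monic) (n : ℕ) :
    binetSeq lam m (n + 1) = ∑ s ∈ Finset.range (m 0 + m 1), fibCoeff P s *
      binetSeq lam m (n - s) := by
  have h := residueSum_mul_eq_zero (a := lam 0) (b := lam 1) (hm 0) (hm 1) (X ^ n)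
  rw [← hP, eq_X_pow_sub_sum_fibCoeff hPm, sub_mul, Finset.sum_mul, map_sub, sub_eq_zero, map_sum,
    hPd, ← pow_add] at h
  have := hm 0
  rw [binetSeq_eq_residueSum lam m hm hne h0 (n + 1) (m 0 + m 1 + n) (by omega), h]
  refine Finset.sum_congr rfl fun s hs => ?_
  rw [Finset.mem_range] at hs
  rw [smul_mul_assoc, map_smul, smul_eq_mul, ← pow_add,
    binetSeq_eq_residueSum lam m hm hne h0 (n - s) (m 0 + m 1 - 1 - s + n) (by omega)]

theorem pow_eq_sum_binetSeq_smul (hm : ∀ i, 1 ≤ m i)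
    (hne : lam 0 ≠ lam 1) (h0 : ∀ i, lam i ≠ 0) {P : ℂ[X]}
    (hP : P = (X - C (lam 0)) ^ m 0 * (X - C (lam 1)) ^ m 1) (hA : aeval A P = 0) (n : ℕ) :
    A ^ n = ∑ s ∈ Finset.range (m 0 + m 1), binetSeq lam m (n - s) • hornerSystem P A s := by
  have hPm : P.Monic := hP ▸ ((monic_X_sub_C _).pow _).mul ((monic_X_sub_C _).pow _)
  have hPd : P.natDegree = m 0 + m 1 := by
    rw [hP, ((monic_X_sub_C _).pow _).natDegree_mul ((monic_X_sub_C _).pow _)]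
    simp
  obtain ⟨r, hr⟩ : ∃ r, m 0 + m 1 = r + 1 := ⟨m 0 + m 1 - 1, by have := hm 0; omega⟩
  have hA0 : hornerSystem P A 0 = 1 := by simp [hornerSystem, hornerPoly]
  induction n with
  | zero =>
    rw [Finset.sum_eq_single 0]
    · have := binetSeq_neg lam m hm hne h0 (s := 0) (by omega)
      simp_all
    · intro s hs hs0
      have := binetSeq_neg lam m hm hne h0 (Finset.mem_range.1 hs)
      rw [if_neg hs0] at this
      simp [this]
    · simp [hr]
  | succ n ih =>
    rw [pow_succ', ih, Finset.mul_sum]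
    simp only [mul_smul_comm, hornerSystem_succ, smul_add, Finset.sum_add_distrib, smul_smul,
      ← Finset.sum_smul]
    have h1 := binetSeq_recurrence lam m hm hne h0 hP hPd hPm n
    simp only [mul_comm (fibCoeff P _)] at h1
    rw [← h1, hr, Finset.sum_range_succ, Finset.sum_range_succ', ← hr, ← hPd,
      hornerSystem_natDegree hPm A hA, hA0]
    simp

end Horner

/-! ### Regrouping `φ_s` and the Binet sequence by powers of `D` and of `n`. -/

section Component

variable {l : ℕ} (lam : Fin l → ℂ) (m : Fin l → ℕ)

/-- The coefficient of `D^k (1 - lam_i t)^(1/p)` in `φ_s`. -/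
noncomputable def phiWeight (i : Fin l) (k s : ℕ) : ℂ :=
  ∑ j ∈ Finset.Ico k (m i),
    binetCoeff lam m i j / lam i ^ s * (j.choose k : ℂ) * (-(s : ℂ)) ^ (j - k)

theorem sum_phiWeight_mul (i : Fin l) (s : ℕ) (f : ℕ → ℂ) :
    ∑ k ∈ Finset.range (m i), phiWeight lam m i k s * f k =
      ∑ j ∈ Finset.range (m i), ∑ k ∈ Finset.range (j + 1),
        binetCoeff lam m i j / lam i ^ s * (j.choose k : ℂ) * (-(s : ℂ)) ^ (j - k) * f k := by
  simp only [phiWeight, Finset.sum_mul]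
  exact Finset.sum_comm' (by intro k j; simp; omega)

theorem phi_eq_sum_phiWeight (hm : ∀ i, 1 ≤ m i) (p s : ℕ) (t : ℝ) :
    phi p lam m s t = ∑ i, ∑ k ∈ Finset.range (m i),
      phiWeight lam m i k s * (degreeOp^[k] (rootFun p (lam i))) t := by
  simp only [sum_phiWeight_mul]
  rw [phi]
  split_ifs with hs
  · subst hs
    refine Finset.sum_congr rfl fun i _ => Finset.sum_congr rfl fun j _ => ?_
    -- At `s = 0` the factor `0^(j-k)` leaves only `k = j`, so the formula for `s ≥ 1` also covers
    -- `φ_0`.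
    rw [Finset.sum_range_succ, Finset.sum_eq_zero, zero_add]
    · simp
    · intro k hk
      rw [Finset.mem_range] at hk
      simp [zero_pow (Nat.sub_ne_zero_of_lt hk)]
  · rw [← Finset.sum_add_distrib]
    refine Finset.sum_congr rfl fun i _ => ?_
    rw [Finset.range_eq_Ico, Finset.sum_eq_sum_Ico_succ_bot (hm i)]
    simp

theorem binetSeq_eq_sum_phiWeight (h0 : ∀ i, lam i ≠ 0) (n s : ℕ) :
    binetSeq lam m (n - s) = ∑ i, ∑ k ∈ Finset.range (m i),
      phiWeight lam m i k s * ((n : ℂ) ^ k * lam i ^ n) := by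
  simp only [sum_phiWeight_mul, binetSeq]
  refine Finset.sum_congr rfl fun i _ => ?_
  rw [zpow_sub₀ (h0 i), zpow_natCast, zpow_natCast, Finset.mul_sum]
  refine Finset.sum_congr rfl fun j _ => ?_
  have : ((n - s : ℤ) : ℂ) = n + -s := by push_cast; ring
  rw [this, add_pow, Finset.mul_sum, Finset.mul_sum]
  refine Finset.sum_congr rfl fun k _ => ?_
  have := h0 i
  field_simp

end Component

/-! ### Matrix components, and their vanishing off the spectrum. -/

section Decomposition

variable {d : ℕ} (A : Matrix (Fin d) (Fin d) ℂ) (P : ℂ[X]) (lam : Fin 2 → ℂ) (m : Fin 2 → ℕ)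

/-- The matrix coefficient of `D^k (1 - lam_i t)^(1/p)` in `∑ s, φ_s(t) A_s`. -/
noncomputable def component (i : Fin 2) (k : ℕ) : Matrix (Fin d) (Fin d) ℂ :=
  ∑ s ∈ Finset.range (m 0 + m 1), phiWeight lam m i k s • hornerSystem P A s

theorem sum_phiWeight_smul_hornerSystem (f : Fin 2 → ℕ → ℂ) :
    ∑ s ∈ Finset.range (m 0 + m 1), (∑ i, ∑ k ∈ Finset.range (m i),
      phiWeight lam m i k s * f i k) • hornerSystem P A s =
      ∑ i, ∑ k ∈ Finset.range (m i), f i k • component A P lam m i k := by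
  simp only [component, Finset.sum_smul, Finset.smul_sum, smul_smul]
  rw [Finset.sum_comm]
  refine Finset.sum_congr rfl fun i _ => ?_
  rw [Finset.sum_comm]
  simp only [mul_comm]

variable {P}

theorem pow_eq_sum_component (hm : ∀ i, 1 ≤ m i)
    (hne : lam 0 ≠ lam 1) (h0 : ∀ i, lam i ≠ 0)
    (hP : P = (X - C (lam 0)) ^ m 0 * (X - C (lam 1)) ^ m 1) (hA : aeval A P = 0) (n : ℕ) :
    A ^ n = ∑ i, ∑ k ∈ Finset.range (m i),
      ((n : ℂ) ^ k * lam i ^ n) • component A P lam m i k := by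
  rw [← sum_phiWeight_smul_hornerSystem A P lam m fun i k => (n : ℂ) ^ k * lam i ^ n,
    pow_eq_sum_binetSeq_smul A lam m hm hne h0 hP hA n]
  simp only [binetSeq_eq_sum_phiWeight lam m h0]

/-- The Euler operator `X d/dX` on polynomials. -/
noncomputable def eulerOp : ℂ[X] →ₗ[ℂ] ℂ[X] :=
  LinearMap.mulLeft ℂ X ∘ₗ derivative

theorem eulerOp_apply (q : ℂ[X]) : eulerOp q = X * derivative q := rfl

theorem eulerOp_pow_X_pow (k n : ℕ) : (eulerOp ^ k) (X ^ n) = (n : ℂ) ^ k • X ^ n := by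
  induction k with
  | zero => simp
  | succ k ih =>
    rw [pow_succ', Module.End.mul_apply, ih, map_smul, eulerOp_apply, derivative_X_pow, pow_succ,
      mul_smul]
    congr 1
    rcases n with _ | n
    · simp
    · rw [Nat.add_sub_cancel, smul_eq_C_mul]
      simp
      ring

/-- Each application of `X d/dX` lowers the guaranteed order of vanishing at `a` by one; for `e = 0`
the successive orders `k, …, 1` and the factors `a` produce `k! a^k`. -/
theorem eulerOp_pow_pow_mul (a : ℂ) (k : ℕ) : ∀ (e : ℕ) (g : ℂ[X]),
    ∃ h : ℂ[X], (eulerOp ^ k) ((X - C a) ^ (e + k) * g) = (X - C a) ^ e * h ∧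
      (e = 0 → h.eval a = k.factorial * a ^ k * g.eval a) := by
  induction k with
  | zero => exact fun e g => ⟨g, by simp⟩
  | succ k ih =>
    intro e g
    obtain ⟨h, h1, h2⟩ := ih e (((e + k + 1 : ℕ) : ℂ[X]) * (X * g) + (X - C a) * (X * derivative g))
    refine ⟨h, ?_, fun he => ?_⟩
    · rw [← h1, pow_succ, Module.End.mul_apply, eulerOp_apply, derivative_mul,
        derivative_X_sub_C_pow, ← add_assoc, Nat.add_sub_cancel]
      congr 1
      simp
      ring
    · rw [h2 he, he, Nat.factorial_succ]
      simp
      ring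

theorem aeval_eq_sum_component (hm : ∀ i, 1 ≤ m i)
    (hne : lam 0 ≠ lam 1) (h0 : ∀ i, lam i ≠ 0)
    (hP : P = (X - C (lam 0)) ^ m 0 * (X - C (lam 1)) ^ m 1) (hA : aeval A P = 0) (q : ℂ[X]) :
    aeval A q = ∑ i, ∑ k ∈ Finset.range (m i),
      ((eulerOp ^ k) q).eval (lam i) • component A P lam m i k := by
  induction q using Polynomial.induction_on' with
  | add p q hp hq => simp only [map_add, hp, hq, eval_add, add_smul, Finset.sum_add_distrib]
  | monomial n c =>
    rw [← mul_one c, ← smul_eq_mul, ← smul_monomial, monomial_one_right_eq_X_pow, map_smul,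
      aeval_X_pow, pow_eq_sum_component A lam m hm hne h0 hP hA]
    simp only [Finset.smul_sum, map_smul, eulerOp_pow_X_pow, eval_smul, eval_pow, eval_X,
      smul_smul, smul_eq_mul, mul_assoc]

/-- As `A - lam i` is invertible, `(A - lam i')^(m i') = 0`. Testing `aeval_eq_sum_component` on `(X
- lam i')^(m i') (X - lam i)^k` isolates the component `k`: the terms at `lam i'` and those of
smaller index vanish by order of vanishing, those of larger index by induction. -/
theorem component_eq_zero (hm : ∀ i, 1 ≤ m i)
    (hne : lam 0 ≠ lam 1) (h0 : ∀ i, lam i ≠ 0)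
    (hP : P = (X - C (lam 0)) ^ m 0 * (X - C (lam 1)) ^ m 1) (hA : aeval A P = 0)
    {i : Fin 2} (hi : lam i ∉ spectrum ℂ A) {k : ℕ} (hk : k < m i) :
    component A P lam m i k = 0 := by
  obtain ⟨i', hi', hP', hl⟩ : ∃ i', i ≠ i' ∧
      P = (X - C (lam i)) ^ m i * (X - C (lam i')) ^ m i' ∧ lam i ≠ lam i' := by
    fin_cases i
    · exact ⟨1, by decide, hP, hne⟩
    · exact ⟨0, by decide, by rw [hP, mul_comm]; rfl, hne.symm⟩
  have hu : IsUnit (aeval A ((X - C (lam i)) ^ m i)) := by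
    rw [spectrum.notMem_iff] at hi
    rw [map_pow]
    refine IsUnit.pow _ ?_
    have := hi.neg
    simpa using this
  have hA' : aeval A ((X - C (lam i')) ^ m i') = 0 := by
    rw [hP', map_mul] at hA
    exact hu.mul_right_eq_zero.1 hA
  -- Downward induction on `k`, with `N` bounding the distance to `m i`.
  have key : ∀ N, ∀ k, k < m i → m i ≤ k + N → component A P lam m i k = 0 := by
    intro N
    induction N with
    | zero => intro k h1 h2; omega
    | succ N ih =>
      intro k h1 h2
      have h := aeval_eq_sum_component A lam m hm hne h0 hP hA
        ((X - C (lam i')) ^ m i' * (X - C (lam i)) ^ k)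
      rw [map_mul, hA', zero_mul, sum_fin_two_of_ne _ hi', Finset.sum_eq_single k] at h
      · rw [Finset.sum_eq_zero, add_zero, eq_comm, smul_eq_zero] at h
        · refine h.resolve_left ?_
          obtain ⟨g, hg, hg'⟩ := eulerOp_pow_pow_mul (lam i) k 0 ((X - C (lam i')) ^ m i')
          rw [zero_add] at hg
          rw [mul_comm, hg, pow_zero, one_mul, hg' rfl]
          have : lam i - lam i' ≠ 0 := sub_ne_zero.2 hl
          have := h0 i
          simp [Nat.factorial_ne_zero, *]
        · intro j hj
          rw [Finset.mem_range] at hj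
          obtain ⟨g, hg, -⟩ := eulerOp_pow_pow_mul (lam i') j (m i' - j) ((X - C (lam i)) ^ k)
          rw [Nat.sub_add_cancel hj.le] at hg
          rw [hg]
          simp [(Nat.sub_pos_of_lt hj).ne']
      · intro j hj hjk
        rw [Finset.mem_range] at hj
        rcases lt_or_gt_of_ne hjk with hjk | hjk
        · obtain ⟨g, hg, -⟩ := eulerOp_pow_pow_mul (lam i) j (k - j) ((X - C (lam i')) ^ m i')
          rw [Nat.sub_add_cancel hjk.le, mul_comm] at hg
          rw [hg]
          simp [(Nat.sub_pos_of_lt hjk).ne']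
        · rw [ih j hj (by omega), smul_zero]
      · simp [h1]
  exact key (m i) k hk (by omega)

end Decomposition

/-! ### The binomial series and termwise action of `D`. -/

section Series

theorem hasSum_mul_deriv_tsum {c : ℕ → ℂ}
    (hc : ∀ r : ℝ, 0 ≤ r → r < 1 → Summable fun n => ‖c n‖ * r ^ n) {z : ℂ} (hz : ‖z‖ < 1) :
    DifferentiableAt ℂ (fun w => ∑' n, c n * w ^ n) z ∧
      HasSum (fun n : ℕ => n * c n * z ^ n) (z * deriv (fun w => ∑' n, c n * w ^ n) z) := by
  obtain ⟨r, hzr, hr⟩ := exists_between hz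
  have hu := hc r ((norm_nonneg z).trans hzr.le) hr
  have hU : IsOpen (Metric.ball (0 : ℂ) r) := Metric.isOpen_ball
  have hzU : z ∈ Metric.ball (0 : ℂ) r := by simpa using hzr
  have hf : ∀ n : ℕ, DifferentiableOn ℂ (fun w => c n * w ^ n) (Metric.ball (0 : ℂ) r) :=
    fun n => by fun_prop
  have hb : ∀ (n : ℕ) (w : ℂ), w ∈ Metric.ball (0 : ℂ) r → ‖c n * w ^ n‖ ≤ ‖c n‖ * r ^ n := by
    intro n w hw
    rw [norm_mul, norm_pow]
    have : ‖w‖ ≤ r := by simpa using (Metric.mem_ball.1 hw).le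
    gcongr
  refine ⟨(Complex.differentiableOn_tsum_of_summable_norm hu hf hU hb).differentiableAt
    (hU.mem_nhds hzU), ?_⟩
  refine ((Complex.hasSum_deriv_of_summable_norm hu hf hU hb hzU).mul_left z).congr_fun fun n => ?_
  rcases n with _ | n
  · simp
  · simp
    ring

theorem taylorCoeff_eq (p n : ℕ) :
    taylorCoeff p n = (-1) ^ n * Ring.choose (1 / (p : ℂ)) n := by
  rw [taylorCoeff, ring_choose_eq_prod, mul_div_assoc]

/-- Each factor satisfies `|1/p - k| ≤ k + 1`, so the product is at most `n!`. -/
theorem norm_taylorCoeff_le_one {p : ℕ} (hp : 1 ≤ p) (n : ℕ) : ‖taylorCoeff p n‖ ≤ 1 := by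
  have hp' : (1 : ℝ) ≤ p := by exact_mod_cast hp
  have h : ∀ n, ‖∏ k ∈ Finset.range n, (1 / (p : ℂ) - (k : ℂ))‖ ≤ n.factorial := by
    intro n
    induction n with
    | zero => simp
    | succ n ih =>
      rw [Finset.prod_range_succ, norm_mul, Nat.factorial_succ, mul_comm]
      push_cast
      refine mul_le_mul ?_ ih (norm_nonneg _) (by positivity)
      have : (1 / (p : ℂ) - (n : ℂ)) = ((1 / (p : ℝ) - n : ℝ) : ℂ) := by push_cast; rfl
      rw [this, Complex.norm_real, Real.norm_eq_abs, abs_le]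
      have h1 : 1 / (p : ℝ) ≤ 1 := by
        rw [div_le_one (by positivity)]
        exact hp'
      have h2 : 0 ≤ 1 / (p : ℝ) := by positivity
      have h3 : (0 : ℝ) ≤ n := by positivity
      constructor <;> linarith
  rw [taylorCoeff, norm_div, norm_mul, norm_pow, norm_neg, norm_one, one_pow, one_mul,
    Complex.norm_natCast, div_le_one (by positivity)]
  exact h n

theorem hasSum_taylorCoeff {p : ℕ} {z : ℂ} (hz : ‖z‖ < 1) :
    HasSum (fun n => taylorCoeff p n * z ^ n) ((1 - z) ^ (1 / (p : ℂ))) := by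
  have h := (Complex.one_add_cpow_hasFPowerSeriesOnBall_zero (a := 1 / (p : ℂ))).hasSum
    (y := -z) (by simpa [← ofReal_norm] using hz)
  rw [zero_add, ← sub_eq_add_neg] at h
  refine h.congr_fun fun n => ?_
  rw [binomialSeries_apply, taylorCoeff_eq, smul_eq_mul, List.ofFn_const, List.prod_replicate,
    neg_pow z]
  ring

theorem summable_taylorCoeff_mul_pow {p : ℕ} (hp : 1 ≤ p) (k : ℕ) {r : ℝ} (hr0 : 0 ≤ r)
    (hr : r < 1) : Summable fun n : ℕ => ‖(n : ℂ) ^ k * taylorCoeff p n‖ * r ^ n := by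
  refine (summable_pow_mul_geometric_of_norm_lt_one k (r := r)
    (by rwa [Real.norm_of_nonneg hr0])).of_nonneg_of_le (fun n => by positivity) fun n => ?_
  rw [norm_mul, norm_pow, Complex.norm_natCast]
  have := norm_taylorCoeff_le_one hp n
  gcongr
  exact mul_le_of_le_one_right (by positivity) this

/-- On the disc of convergence, `D` acts on the binomial series termwise. -/
theorem hasSum_degreeOp_rootFun {p : ℕ} (hp : 1 ≤ p) (c : ℂ) (k : ℕ) :
    ∀ t : ℝ, ‖c * t‖ < 1 → HasSum (fun n : ℕ => (n : ℂ) ^ k * taylorCoeff p n * (c * t) ^ n)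
      ((degreeOp^[k] (rootFun p c)) t) := by
  induction k with
  | zero =>
    intro t ht
    simpa [rootFun] using hasSum_taylorCoeff (p := p) ht
  | succ k ih =>
    intro t ht
    obtain ⟨h1, h2⟩ := hasSum_mul_deriv_tsum (c := fun n => (n : ℂ) ^ k * taylorCoeff p n)
      (fun r h0 h => summable_taylorCoeff_mul_pow hp k h0 h) ht
    -- Differentiating requires equality near `t`, which holds because the convergence condition is
    -- open.
    have hev : degreeOp^[k] (rootFun p c) =ᶠ[nhds t]
        fun x : ℝ => ∑' n : ℕ, (n : ℂ) ^ k * taylorCoeff p n * (c * x) ^ n := by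
      have ho : IsOpen {x : ℝ | ‖c * x‖ < 1} := isOpen_lt (by fun_prop) continuous_const
      filter_upwards [ho.mem_nhds ht] with x hx
      exact (ih x hx).tsum_eq.symm
    have hd : HasDerivAt (fun x : ℝ => ∑' n : ℕ, (n : ℂ) ^ k * taylorCoeff p n * (c * x) ^ n)
        (deriv (fun w => ∑' n : ℕ, (n : ℂ) ^ k * taylorCoeff p n * w ^ n) (c * t) * c) t := by
      have hl : HasDerivAt (fun x : ℂ => c * x) c (t : ℂ) := by
        simpa using (hasDerivAt_id (t : ℂ)).const_mul c
      exact (h1.hasDerivAt.comp (t : ℂ) hl).comp_ofReal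
    rw [Function.iterate_succ_apply', degreeOp, hev.deriv_eq, hd.deriv]
    convert h2 using 1
    · ext n
      ring
    · ring

end Series

/-! ### Common eigenvectors and uniqueness of commuting principal roots. -/

section Spectrum

open Matrix

variable {d : ℕ}

theorem mem_spectrum_of_mulVec {A : Matrix (Fin d) (Fin d) ℂ} {v : Fin d → ℂ} (hv : v ≠ 0) {z : ℂ}
    (h : A *ᵥ v = z • v) : z ∈ spectrum ℂ A := by
  rw [← Matrix.spectrum_toLin', ← Module.End.hasEigenvalue_iff_mem_spectrum]
  exact Module.End.hasEigenvalue_of_hasEigenvector (x := v)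
    ⟨Module.End.mem_eigenspace_iff.2 (by simpa using h), hv⟩

/-- `A` preserves the eigenspace of `X`, and its restriction there has an eigenvalue. -/
theorem exists_common_eigenvector {A X : Matrix (Fin d) (Fin d) ℂ} (hc : Commute X A) {z : ℂ}
    (hz : z ∈ spectrum ℂ X) :
    ∃ v : Fin d → ℂ, v ≠ 0 ∧ X *ᵥ v = z • v ∧ ∃ μ : ℂ, A *ᵥ v = μ • v := by
  rw [← Matrix.spectrum_toLin', ← Module.End.hasEigenvalue_iff_mem_spectrum] at hz
  have hc' : Commute (toLin' X) (toLin' A) := by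
    rw [Commute, SemiconjBy, Module.End.mul_eq_comp, Module.End.mul_eq_comp, ← toLin'_mul,
      ← toLin'_mul, hc.eq]
  have hmaps : Set.MapsTo (toLin' A) (Module.End.eigenspace (toLin' X) z)
      (Module.End.eigenspace (toLin' X) z) :=
    Module.End.mapsTo_genEigenspace_of_comm hc' z 1
  have : Nontrivial (Module.End.eigenspace (toLin' X) z) :=
    Submodule.nontrivial_iff_ne_bot.2 hz
  obtain ⟨μ, hμ⟩ := Module.End.exists_eigenvalue ((toLin' A).restrict hmaps)
  obtain ⟨w, hw⟩ := hμ.exists_hasEigenvector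
  refine ⟨w, fun h => hw.2 (Subtype.ext h), ?_, μ, ?_⟩
  · simpa using Module.End.mem_eigenspace_iff.1 w.2
  · have h : toLin' A w = μ • (w : Fin d → ℂ) := congrArg Subtype.val hw.apply_eq_smul
    rwa [toLin'_apply] at h

theorem pow_mulVec_eq_smul {A : Matrix (Fin d) (Fin d) ℂ} {v : Fin d → ℂ} {μ : ℂ}
    (h : A *ᵥ v = μ • v) (n : ℕ) : (A ^ n) *ᵥ v = μ ^ n • v := by
  induction n with
  | zero => simp
  | succ n ih => rw [pow_succ', ← mulVec_mulVec, ih, mulVec_smul, h, smul_smul, pow_succ]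

theorem eq_of_pow_eq_of_abs_arg_lt {p : ℕ} (hp : p ≠ 0) {x y : ℂ} (h : x ^ p = y ^ p)
    (hx : |Complex.arg x| < Real.pi / p) (hy : |Complex.arg y| < Real.pi / p) : x = y := by
  rw [abs_lt] at hx hy
  rw [← Complex.pow_cpow_nat_inv hp hx.1 hx.2.le, h, Complex.pow_cpow_nat_inv hp hy.1 hy.2.le]

/-- Commuting principal roots coincide. -/
theorem IsPrincipalRoot.eq_of_commute {p : ℕ} (hp : p ≠ 0) {B X Y : Matrix (Fin d) (Fin d) ℂ}
    (hX : IsPrincipalRoot p B X) (hY : IsPrincipalRoot p B Y) (hXY : Commute X Y) : Y = X := by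
  have hu : IsUnit X := by
    by_contra h
    exact (hX.2 0 (spectrum.zero_mem_iff ℂ |>.2 h)).1 rfl
  obtain ⟨u, rfl⟩ := hu
  -- The quotient `Z = Y X⁻¹` has `Z^p = 1`; the argument bounds force all its eigenvalues to be
  -- `1`.
  obtain ⟨Z, hZ⟩ : ∃ Z, Z = Y * ((u⁻¹ : (Matrix (Fin d) (Fin d) ℂ)ˣ) : Matrix (Fin d) (Fin d) ℂ) :=
    ⟨_, rfl⟩
  have hYZ : Y = Z * (u : Matrix (Fin d) (Fin d) ℂ) := by simp [hZ]
  have hcY : Commute Y ((u⁻¹ : (Matrix (Fin d) (Fin d) ℂ)ˣ) : Matrix (Fin d) (Fin d) ℂ) :=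
    hXY.symm.units_inv_right
  have hcZ : Commute Z (u : Matrix (Fin d) (Fin d) ℂ) := by
    rw [hZ]
    exact hXY.symm.mul_left (by simp [Commute, SemiconjBy])
  have hZp : Z ^ p = 1 := by
    rw [hZ, hcY.mul_pow, hY.1, ← hX.1]
    simp [← Units.val_pow_eq_pow_val]
  have hspec : ∀ ω ∈ spectrum ℂ Z, ω = 1 := by
    intro ω hω
    obtain ⟨v, hv, h1, x, h2⟩ := exists_common_eigenvector hcZ hω
    have h3 : Y *ᵥ v = (x * ω) • v := by
      rw [hYZ, ← mulVec_mulVec, h2, mulVec_smul, h1, smul_smul]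
    obtain ⟨hx0, hx⟩ := hX.2 x (mem_spectrum_of_mulVec hv h2)
    obtain ⟨-, hy⟩ := hY.2 _ (mem_spectrum_of_mulVec hv h3)
    have h4 : (x * ω) ^ p = x ^ p := by
      have h5 := pow_mulVec_eq_smul h3 p
      rw [hY.1, ← hX.1, pow_mulVec_eq_smul h2 p] at h5
      exact (smul_left_injective ℂ hv h5).symm
    exact mul_left_cancel₀ hx0 ((eq_of_pow_eq_of_abs_arg_lt hp h4 hy hx).trans (mul_one x).symm)
  -- The only possible eigenvalue of this sum is `p ≠ 0`, so it can be cancelled from `(Z - 1) ∑ Z^j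
  -- = Z^p - 1 = 0`.
  have hS : IsUnit (∑ j ∈ Finset.range p, Z ^ j) := by
    by_contra h
    obtain ⟨v, hv, h1, ω, h2⟩ := exists_common_eigenvector (A := Z)
      (Commute.sum_left _ _ _ fun j _ => Commute.pow_self Z j) ((spectrum.zero_mem_iff ℂ).2 h)
    rw [sum_mulVec] at h1
    simp only [pow_mulVec_eq_smul h2, hspec ω (mem_spectrum_of_mulVec hv h2), one_pow, one_smul,
      zero_smul, Finset.sum_const, Finset.card_range] at h1
    exact hv ((smul_eq_zero.1 h1).resolve_left hp)
  have hZ1 : Z = 1 := by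
    have h := mul_geom_sum Z p
    rw [hZp, sub_self] at h
    exact sub_eq_zero.1 (hS.mul_left_eq_zero.1 h)
  rw [hYZ, hZ1, one_mul]

end Spectrum

/-! ### The `p`th power of the binomial series. -/

section PowerSeries

/-- Absolute convergence lets Cauchy products carry formal identities over to the algebra `R`. -/
theorem hasSum_coeff_pow_smul {R : Type*} [NormedRing R] [NormedAlgebra ℂ R] [CompleteSpace R]
    {f : PowerSeries ℂ} {T x : R} (hs : Summable fun n => ‖PowerSeries.coeff n f • T ^ n‖)
    (hx : HasSum (fun n => PowerSeries.coeff n f • T ^ n) x) (j : ℕ) :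
    (Summable fun n => ‖PowerSeries.coeff n (f ^ j) • T ^ n‖) ∧
      HasSum (fun n => PowerSeries.coeff n (f ^ j) • T ^ n) (x ^ j) := by
  induction j with
  | zero =>
    have h : ∀ n, n ≠ 0 → PowerSeries.coeff n (f ^ 0) • T ^ n = 0 := by
      intro n hn
      rw [pow_zero, PowerSeries.coeff_one, if_neg hn, zero_smul]
    refine ⟨summable_of_ne_finset_zero (s := {0}) fun n hn => ?_, ?_⟩
    · rw [h n (by simpa using hn), norm_zero]
    · simpa using hasSum_single 0 h
  | succ j ih =>
    have e : ∀ n, PowerSeries.coeff n (f ^ (j + 1)) • T ^ n =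
        ∑ kl ∈ Finset.HasAntidiagonal.antidiagonal n,
          (PowerSeries.coeff kl.1 (f ^ j) • T ^ kl.1) * (PowerSeries.coeff kl.2 f • T ^ kl.2) := by
      intro n
      rw [pow_succ, PowerSeries.coeff_mul, Finset.sum_smul]
      refine Finset.sum_congr rfl fun kl hkl => ?_
      rw [smul_mul_smul_comm, ← pow_add, Finset.HasAntidiagonal.mem_antidiagonal.1 hkl]
    have h1 := summable_norm_sum_mul_antidiagonal_of_summable_norm ih.1 hs
    have h2 := tsum_mul_tsum_eq_tsum_sum_antidiagonal_of_summable_norm ih.1 hs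
    simp only [← e] at h1 h2
    refine ⟨h1, ?_⟩
    rw [pow_succ x, ← ih.2.tsum_eq, ← hx.tsum_eq, h2]
    exact h1.of_norm.hasSum

/-- Exponents of binomial series add, so the `p`th power has exponent `1`. -/
theorem mk_taylorCoeff_pow {p : ℕ} (hp : p ≠ 0) :
    (PowerSeries.mk (taylorCoeff p)) ^ p = 1 - PowerSeries.X := by
  have h : PowerSeries.mk (taylorCoeff p) =
      PowerSeries.rescale (-1) (PowerSeries.binomialSeries ℂ (1 / (p : ℂ))) := by
    ext n
    simp [taylorCoeff_eq, PowerSeries.coeff_rescale]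
  have h2 : ∀ j : ℕ, PowerSeries.binomialSeries ℂ (1 / (p : ℂ)) ^ j =
      PowerSeries.binomialSeries ℂ (j * (1 / (p : ℂ))) := by
    intro j
    induction j with
    | zero => simp
    | succ j ih =>
      rw [pow_succ, ih, ← PowerSeries.binomialSeries_add]
      congr 1
      push_cast
      ring
  have hp' : (p : ℂ) ≠ 0 := by exact_mod_cast hp
  rw [h, ← map_pow, h2, mul_one_div_cancel hp', ← Nat.cast_one, PowerSeries.binomialSeries_nat,
    pow_one]
  simp [sub_eq_add_neg]

theorem hasSum_coeff_one_sub_X_smul {R : Type*} [Ring R] [Algebra ℂ R] [TopologicalSpace R]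
    (T : R) : HasSum
      (fun n => PowerSeries.coeff n (1 - PowerSeries.X : PowerSeries ℂ) • T ^ n) (1 - T) := by
  have h : ∑ n ∈ Finset.range 2, PowerSeries.coeff n (1 - PowerSeries.X : PowerSeries ℂ) • T ^ n =
      1 - T := by
    simp [Finset.sum_range_succ, PowerSeries.coeff_one, PowerSeries.coeff_X, sub_eq_add_neg]
  rw [← h]
  refine hasSum_sum_of_ne_finset_zero fun n hn => ?_
  rw [Finset.mem_range, not_lt] at hn
  rw [map_sub, PowerSeries.coeff_one, PowerSeries.coeff_X, if_neg (by omega),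
    if_neg (by omega), sub_zero, zero_smul]

theorem summable_norm_of_summable {E : Type*} [NormedAddCommGroup E] [NormedSpace ℂ E]
    [FiniteDimensional ℂ E] {f : ℕ → E} (hf : Summable f) : Summable fun n => ‖f n‖ := by
  let : NormedSpace ℝ E := NormedSpace.restrictScalars ℝ ℂ E
  have : FiniteDimensional ℝ E := FiniteDimensional.complexToReal E
  exact summable_norm_iff.2 hf

theorem pow_eq_of_hasSum_taylorCoeff {R : Type*} [NormedRing R] [NormedAlgebra ℂ R]
    [FiniteDimensional ℂ R] {p : ℕ} (hp : p ≠ 0) {T x : R}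
    (h : HasSum (fun n => taylorCoeff p n • T ^ n) x) : x ^ p = 1 - T := by
  have : CompleteSpace R := FiniteDimensional.complete ℂ R
  have h' : HasSum (fun n => PowerSeries.coeff n (PowerSeries.mk (taylorCoeff p)) • T ^ n) x := by
    simpa only [PowerSeries.coeff_mk] using h
  have hs : Summable fun n => ‖PowerSeries.coeff n (PowerSeries.mk (taylorCoeff p)) • T ^ n‖ :=
    summable_norm_of_summable h'.summable
  have h1 := (hasSum_coeff_pow_smul hs h' p).2
  rw [mk_taylorCoeff_pow hp] at h1
  exact h1.unique (hasSum_coeff_one_sub_X_smul T)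

end PowerSeries

/-! ### Summing the matrix series and locating its eigenvalues. -/

section Main

open Matrix

variable {d : ℕ} {A : Matrix (Fin d) (Fin d) ℂ}

theorem commute_aeval {R : Type*} [Ring R] [Algebra ℂ R] {a y : R} (h : Commute y a) (q : ℂ[X]) :
    Commute y (aeval a q) := by
  induction q using Polynomial.induction_on' with
  | add p q hp hq => rw [map_add]; exact hp.add_right hq
  | monomial n c =>
    rw [aeval_monomial]
    exact (Algebra.commute_algebraMap_right c y).mul_right (h.pow_right n)

theorem norm_mul_lt_one_of_mem_spectrum {t : ℝ}
    (ht : ENNReal.ofReal |t| * spectralRadius ℂ A < 1) {z : ℂ} (hz : z ∈ spectrum ℂ A) :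
    ‖z * t‖ < 1 := by
  have h1 : (‖z‖₊ : ENNReal) ≤ spectralRadius ℂ A :=
    le_iSup₂ (f := fun (k : ℂ) (_ : k ∈ spectrum ℂ A) => (‖k‖₊ : ENNReal)) z hz
  have h2 : ENNReal.ofReal (|t| * ‖z‖) < 1 := by
    rw [ENNReal.ofReal_mul (abs_nonneg t), ofReal_norm]
    exact (mul_le_mul_right h1 _).trans_lt ht
  rw [ENNReal.ofReal_lt_one] at h2
  rwa [norm_mul, Complex.norm_real, Real.norm_eq_abs, mul_comm]

theorem hasSum_taylorCoeff_smul_pow (lam : Fin 2 → ℂ) (m : Fin 2 → ℕ) (hm : ∀ i, 1 ≤ m i)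
    (hne : lam 0 ≠ lam 1) (h0 : ∀ i, lam i ≠ 0) {P : ℂ[X]}
    (hP : P = (X - C (lam 0)) ^ m 0 * (X - C (lam 1)) ^ m 1) (hA : aeval A P = 0)
    {p : ℕ} (hp : 1 ≤ p) {t : ℝ} (ht : ENNReal.ofReal |t| * spectralRadius ℂ A < 1) :
    HasSum (fun n : ℕ => (taylorCoeff p n * (t : ℂ) ^ n) • A ^ n)
      (∑ s ∈ Finset.range (m 0 + m 1), phi p lam m s t • hornerSystem P A s) := by
  simp only [phi_eq_sum_phiWeight lam m hm]
  rw [sum_phiWeight_smul_hornerSystem A P lam m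
    fun i k => (degreeOp^[k] (rootFun p (lam i))) t]
  have e : ∀ n : ℕ, (taylorCoeff p n * (t : ℂ) ^ n) • A ^ n = ∑ i, ∑ k ∈ Finset.range (m i),
      ((n : ℂ) ^ k * taylorCoeff p n * (lam i * t) ^ n) • component A P lam m i k := by
    intro n
    rw [pow_eq_sum_component A lam m hm hne h0 hP hA n]
    simp only [Finset.smul_sum, smul_smul]
    refine Finset.sum_congr rfl fun i _ => Finset.sum_congr rfl fun k _ => ?_
    congr 1
    ring
  simp only [e]
  refine hasSum_sum fun i _ => hasSum_sum fun k hk => ?_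
  -- Eigenvalues satisfy `|lam i * t| < 1`; for any other root the component is zero and convergence
  -- is not needed.
  by_cases hi : lam i ∈ spectrum ℂ A
  · exact (hasSum_degreeOp_rootFun hp (lam i) k t
      (norm_mul_lt_one_of_mem_spectrum ht hi)).smul_const _
  · simp only [component_eq_zero A lam m hm hne h0 hP hA hi (Finset.mem_range.1 hk), smul_zero]
    exact hasSum_zero

theorem arg_cpow_one_div {p : ℕ} (hp : 1 ≤ p) {w : ℂ} (hw : w ≠ 0) :
    Complex.arg (w ^ (1 / (p : ℂ))) = Complex.arg w / p := by
  have hp' : (1 : ℝ) ≤ p := by exact_mod_cast hp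
  have him : (Complex.log w * (1 / (p : ℂ))).im = Complex.arg w / p := by
    rw [mul_one_div, Complex.div_natCast_im, Complex.log_im]
  have hle : |Complex.arg w / p| ≤ |Complex.arg w| := by
    rw [abs_div, Nat.abs_cast]
    exact div_le_self (abs_nonneg _) hp'
  have h1 : -Real.pi < Complex.arg w / p := by
    rw [lt_div_iff₀ (by positivity)]
    nlinarith [Complex.neg_pi_lt_arg w, Real.pi_pos]
  have h2 := (le_abs_self _).trans (hle.trans (Complex.abs_arg_le_pi w))
  rw [Complex.cpow_def_of_ne_zero hw, ← Complex.log_im, Complex.log_exp] <;> rw [him]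
  · exact h1
  · exact h2

/-- On a common eigenvector of `X` and `A` the matrix series becomes scalar, so `z = (1 -
μt)^(1/p)`; as `Re (1 - μt) > 0`, the argument of `1 - μt` stays below `π` in absolute value. -/
theorem spectrum_subset_of_hasSum_taylorCoeff {p : ℕ} (hp : 2 ≤ p) {t : ℝ}
    (ht : ENNReal.ofReal |t| * spectralRadius ℂ A < 1) {X : Matrix (Fin d) (Fin d) ℂ}
    (hX : HasSum (fun n : ℕ => (taylorCoeff p n * (t : ℂ) ^ n) • A ^ n) X) (hc : Commute X A)
    {z : ℂ} (hz : z ∈ spectrum ℂ X) : z ≠ 0 ∧ |Complex.arg z| < Real.pi / p := by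
  obtain ⟨v, hv, h1, μ, h2⟩ := exists_common_eigenvector hc hz
  have hμ := norm_mul_lt_one_of_mem_spectrum ht (mem_spectrum_of_mulVec hv h2)
  obtain ⟨j, hj⟩ := Function.ne_iff.1 hv
  have h3 := hX.map (AddMonoidHom.mk' (fun M : Matrix (Fin d) (Fin d) ℂ => (M *ᵥ v) j)
    fun M N => by simp [add_mulVec]) (by
      change Continuous fun M : Matrix (Fin d) (Fin d) ℂ => (M *ᵥ v) j
      simp only [mulVec, dotProduct]
      fun_prop)
  have h4 : HasSum (fun n => taylorCoeff p n * (μ * t) ^ n * v j) (z * v j) := by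
    convert h3 using 1
    · ext n
      simp [smul_mulVec, pow_mulVec_eq_smul h2, mul_pow]
      ring
    · simp [h1]
  have hz' : z = (1 - μ * t) ^ (1 / (p : ℂ)) :=
    mul_right_cancel₀ hj (h4.unique ((hasSum_taylorCoeff (p := p) hμ).mul_right (v j)))
  have hre : 0 < (1 - μ * t).re := by
    rw [Complex.sub_re, Complex.one_re, sub_pos]
    exact (Complex.re_le_norm _).trans_lt hμ
  have hw : 1 - μ * t ≠ 0 := fun h => by simp [h] at hre
  rw [hz', arg_cpow_one_div (by omega) hw, abs_div, Nat.abs_cast]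
  refine ⟨by simp [Complex.cpow_eq_zero_iff, hw], ?_⟩
  have : |Complex.arg (1 - μ * t)| < Real.pi :=
    (Complex.abs_arg_lt_pi_div_two_iff.2 (Or.inl hre)).trans (half_lt_self Real.pi_pos)
  have hp' : (0 : ℝ) < p := by positivity
  gcongr

end Main

end MatrixRoot

theorem proposition3p7 {d : ℕ} (A : Matrix (Fin d) (Fin d) ℂ) (p : ℕ) (hp : 2 ≤ p)
    (lam : Fin 2 → ℂ) (m : Fin 2 → ℕ) (hm : ∀ i, 2 ≤ m i)
    (hne : lam 0 ≠ lam 1) (h0 : ∀ i, lam i ≠ 0)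
    (P : Polynomial ℂ)
    (hPdef : P = (Polynomial.X - Polynomial.C (lam 0)) ^ m 0 *
      (Polynomial.X - Polynomial.C (lam 1)) ^ m 1)
    (hPA : Polynomial.aeval A P = 0)
    (t : ℝ) (ht0 : t ≠ 0) (ht : ENNReal.ofReal |t| * spectralRadius ℂ A < 1) :
    HasSum (fun n : ℕ => (MatrixRoot.taylorCoeff p n * (t : ℂ) ^ n) • A ^ n)
        (∑ s ∈ Finset.range (m 0 + m 1),
          MatrixRoot.phi p lam m s t • MatrixRoot.hornerSystem P A s) ∧
      ∀ Y : Matrix (Fin d) (Fin d) ℂ,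
        MatrixRoot.IsPrincipalRoot p (1 - (t : ℂ) • A) Y ↔
          Y = ∑ s ∈ Finset.range (m 0 + m 1),
            MatrixRoot.phi p lam m s t • MatrixRoot.hornerSystem P A s := by
  have hS := MatrixRoot.hasSum_taylorCoeff_smul_pow lam m (fun i => (by simp : 1 ≤ 2).trans (hm i))
    hne h0 hPdef hPA (by omega : 1 ≤ p) ht
  refine ⟨hS, ?_⟩
  have hcomm : ∀ Y : Matrix (Fin d) (Fin d) ℂ, Commute Y A →
      Commute (∑ s ∈ Finset.range (m 0 + m 1),
        MatrixRoot.phi p lam m s t • MatrixRoot.hornerSystem P A s) Y := by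
    intro Y hY
    refine Commute.sum_left _ _ _ fun s _ => Commute.smul_left ?_ _
    exact (MatrixRoot.commute_aeval hY _).symm
  generalize (∑ s ∈ Finset.range (m 0 + m 1),
    MatrixRoot.phi p lam m s t • MatrixRoot.hornerSystem P A s) = X at hS hcomm ⊢
  have hX : MatrixRoot.IsPrincipalRoot p (1 - (t : ℂ) • A) X := by
    refine ⟨?_, fun z hz => MatrixRoot.spectrum_subset_of_hasSum_taylorCoeff hp ht hS
      (hcomm A (Commute.refl A)) hz⟩
    -- The norm is auxiliary: it induces the entrywise topology in which `hS` is stated.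
    let : NormedRing (Matrix (Fin d) (Fin d) ℂ) := Matrix.linftyOpNormedRing
    let : NormedAlgebra ℂ (Matrix (Fin d) (Fin d) ℂ) := Matrix.linftyOpNormedAlgebra
    refine MatrixRoot.pow_eq_of_hasSum_taylorCoeff (by omega) ?_
    simp only [_root_.smul_pow, smul_smul]
    exact hS
  refine fun Y => ⟨fun hY => hX.eq_of_commute (by omega) hY (hcomm Y ?_), fun h => h ▸ hX⟩
  -- `Y` commutes with `Y^p = 1 - tA`; dividing by `t ≠ 0` shows that it commutes with `A`.
  have h1 : Commute Y (1 - (t : ℂ) • A) := hY.1 ▸ Commute.self_pow Y p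
  have h2 : Commute Y ((t : ℂ) • A) := by
    simpa using (Commute.one_right Y).sub_right h1
  have ht' : (t : ℂ) ≠ 0 := by exact_mod_cast ht0
  have h3 := h2.smul_right ((t : ℂ)⁻¹)
  rwa [smul_smul, inv_mul_cancel₀ ht', one_smul] at h3
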